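/- Let $n,m\ge 0$ be integers, $\gamma>0$ and $L\ge 0$, and let $f:\mathbb{R}^n\times\mathbb{R}^m\to\mathbb{R}^n$ and $r:\mathbb{R}^n\times\mathbb{R}^m\to\mathbb{R}$ be bounded and Lipschitz continuous. Let $\mathcal{A}$ be the set of Lipschitz continuous controls $a:[0,\infty)\to\mathbb{R}^m$ with $|\dot a(t)|\le L$ for almost every $t$. For $(\boldsymbol{x},\boldsymbol{a})\in\mathbb{R}^n\times\mathbb{R}^m$ define the optimal Q-function $$Q(\boldsymbol{x},\boldsymbol{a})=\sup\Big\{\int_0^\infty e^{-\gamma t}\,r(x(t),a(t))\,\mathrm{d}t \;:\; a\in\mathcal{A},\ a(0)=\boldsymbol{a},\ \dot x(t)=f(x(t),a(t))\ (t>0),\ x(0)=\boldsymbol{x}\Big\},$$ where $x$ is continuous on $[0,\infty)$. A viscosity solution of an equation $F(z,u(z),\nabla u(z))=0$ on $\mathbb{R}^k$ is a continuous function $u:\mathbb{R}^k\to\mathbb{R}$ such that, for every $\phi\in C^1(\mathbb{R}^k)$ and $z_0 \in \mathbb{R}^k$, $F(z_0,u(z_0),\nabla\phi(z_0))\le 0$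 if $u-\phi$ has a local maximum at $z_0$, and $F(z_0,u(z_0),\nabla\phi(z_0))\ge 0$ if $u-\phi$ has a local minimum at $z_0$. Then the supremum defining $Q$ is over a nonempty set and finite at every point, $Q$ is bounded, and $Q$ is a viscosity solution on $\mathbb{R}^n\times\mathbb{R}^m$ of the Hamilton–Jacobi–Bellman equation $$\gamma Q-\nabla_{\boldsymbol{x}}Q\cdot f-L\,|\nabla_{\boldsymbol{a}}Q|-r=0.$$ Moreover, it is the only bounded one: every bounded viscosity solution $u$ of this equation is equal to $Q$. -/

import Mathlib

open Set MeasureTheory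

noncomputable section

/-- The space `ℝⁿ × ℝᵐ` of pairs `(x, a)` of a state and an action, with its Euclidean structure. -/
abbrev StateAction (n m : ℕ) : Type :=
  WithLp 2 (EuclideanSpace ℝ (Fin n) × EuclideanSpace ℝ (Fin m))

/-- The point `(x, a)` of `ℝⁿ × ℝᵐ`. -/
def StateAction.mk {n m : ℕ} (x : EuclideanSpace ℝ (Fin n)) (a : EuclideanSpace ℝ (Fin m)) :
    StateAction n m :=
  WithLp.toLp 2 (x, a)

/-- `u` is a viscosity solution of the Hamilton-Jacobi equation `F (z, u z, ∇u z) = 0` on the whole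
Euclidean space `E`. -/
structure IsViscositySolution {E : Type*} [NormedAddCommGroup E] [InnerProductSpace ℝ E]
    [CompleteSpace E] (F : E → ℝ → E → ℝ) (u : E → ℝ) : Prop where
  continuous : Continuous u
  subsolution : ∀ (φ : E → ℝ) (z : E), ContDiff ℝ 1 φ → IsLocalMax (fun y => u y - φ y) z →
    F z (u z) (gradient φ z) ≤ 0
  supersolution : ∀ (φ : E → ℝ) (z : E), ContDiff ℝ 1 φ → IsLocalMin (fun y => u y - φ y) z →
    0 ≤ F z (u z) (gradient φ z)

/-- The function `F(z, q, p) = γ q - p₁ ⬝ f(z) - L |p₂| - r(z)` of the HJB equation, where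
`p = (p₁, p₂)`. -/
def hjbFunction {n m : ℕ} (f : StateAction n m → EuclideanSpace ℝ (Fin n))
    (r : StateAction n m → ℝ) (γ L : ℝ) (z : StateAction n m) (q : ℝ) (p : StateAction n m) : ℝ :=
  γ * q - inner ℝ p.fst (f z) - L * ‖p.snd‖ - r z

/-- Admissible controls: Lipschitz continuous functions `a : [0, ∞) → ℝᵐ` with `|ȧ(t)| ≤ L` for
almost every `t`. (Only the values of `a` on `[0, ∞)` matter.) -/
def IsAdmissibleControl {m : ℕ} (L : ℝ) (a : ℝ → EuclideanSpace ℝ (Fin m)) : Prop :=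
  (∃ K, LipschitzOnWith K a (Ici 0)) ∧
    ∀ᵐ t ∂(volume.restrict (Ioi (0 : ℝ))), DifferentiableAt ℝ a t ∧ ‖deriv a t‖ ≤ L

/-- `x : [0, ∞) → ℝⁿ` is the state trajectory with `ẋ(t) = f(x(t), a(t))` for `t > 0` and
`x(0) = x₀`. (Only the values of `x` on `[0, ∞)` matter.) -/
structure IsTrajectory {n m : ℕ} (f : StateAction n m → EuclideanSpace ℝ (Fin n))
    (a : ℝ → EuclideanSpace ℝ (Fin m)) (x₀ : EuclideanSpace ℝ (Fin n))
    (x : ℝ → EuclideanSpace ℝ (Fin n)) : Prop where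
  continuousOn : ContinuousOn x (Ici 0)
  initial : x 0 = x₀
  hasDerivAt : ∀ t : ℝ, 0 < t → HasDerivAt x (f (StateAction.mk (x t) (a t))) t

/-- The discounted total reward `∫₀^∞ e^{-γ t} r(x(t), a(t)) dt`. -/
def discountedReward {n m : ℕ} (r : StateAction n m → ℝ) (γ : ℝ)
    (x : ℝ → EuclideanSpace ℝ (Fin n)) (a : ℝ → EuclideanSpace ℝ (Fin m)) : ℝ :=
  ∫ t in Ioi (0 : ℝ), Real.exp (-γ * t) * r (StateAction.mk (x t) (a t))

/-- The set of discounted rewards that can be attained by admissible controls, starting from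
`x(0) = x` and `a(0) = a`, where `z = (x, a)`. -/
def attainableRewards {n m : ℕ} (f : StateAction n m → EuclideanSpace ℝ (Fin n))
    (r : StateAction n m → ℝ) (γ L : ℝ) (z : StateAction n m) : Set ℝ :=
  {J | ∃ (a : ℝ → EuclideanSpace ℝ (Fin m)) (x : ℝ → EuclideanSpace ℝ (Fin n)),
    IsAdmissibleControl L a ∧ a 0 = z.snd ∧ IsTrajectory f a z.fst x ∧
      J = discountedReward r γ x a}

/-- The optimal continuous-time Q-function. -/
def optimalQ {n m : ℕ} (f : StateAction n m → EuclideanSpace ℝ (Fin n))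
    (r : StateAction n m → ℝ) (γ L : ℝ) (z : StateAction n m) : ℝ :=
  sSup (attainableRewards f r γ L z)

end

open scoped NNReal Topology

namespace StateAction

variable {n m : ℕ}

/-! A curve is an admissible control exactly when it is `L`-Lipschitz on `[0, ∞)`, so controls may
be shifted, translated and concatenated. Translation and Gronwall make Q continuous. Shifting and
concatenation give the dynamic programming principle (`discountedReward_le_add_optimalQ`,
`add_optimalQ_le_optimalQ`), which compares Q at `z` with the reward on `[0, h]` plus the discounted
Q at the point reached.

Replace Q there by a test function with gradient `p`, expand to first order in `h`, divide by `h`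
and let `h → 0`. The action moves by at most `L h`, so it contributes at most `L ‖p.snd‖` per unit
of time; this gives the subsolution inequality. Moving at speed `L` along `p.snd` attains this rate
and gives the supersolution inequality.

Uniqueness is a comparison principle proved by doubling variables: maximize `u z - v w - s² ‖z‖² - c
‖z - w‖²`. The `s²` term supplies compactness, and `c` is chosen so that `c ‖z - w‖² ≤ s²`. The two
viscosity inequalities at the maximum then bound `γ (u - v)` by an error vanishing with `s`. -/

@[simp] theorem mk_fst (x : EuclideanSpace ℝ (Fin n)) (a : EuclideanSpace ℝ (Fin m)) :
    (mk x a).fst = x := rfl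

@[simp] theorem mk_snd (x : EuclideanSpace ℝ (Fin n)) (a : EuclideanSpace ℝ (Fin m)) :
    (mk x a).snd = a := rfl

@[simp] theorem mk_fst_snd (z : StateAction n m) : mk z.fst z.snd = z := rfl

theorem norm_fst_le (z : StateAction n m) : ‖z.fst‖ ≤ ‖z‖ := by
  rw [WithLp.prod_norm_eq_of_L2]
  exact Real.le_sqrt_of_sq_le (by nlinarith [sq_nonneg ‖z.snd‖])

theorem norm_snd_le (z : StateAction n m) : ‖z.snd‖ ≤ ‖z‖ := by
  rw [WithLp.prod_norm_eq_of_L2]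
  exact Real.le_sqrt_of_sq_le (by nlinarith [sq_nonneg ‖z.fst‖])

theorem norm_le_add (z : StateAction n m) : ‖z‖ ≤ ‖z.fst‖ + ‖z.snd‖ := by
  rw [WithLp.prod_norm_eq_of_L2]
  exact Real.sqrt_le_iff.2 ⟨by positivity, by nlinarith [norm_nonneg z.fst, norm_nonneg z.snd]⟩

theorem inner_eq (z w : StateAction n m) :
    inner ℝ z w = inner ℝ z.fst w.fst + inner ℝ z.snd w.snd :=
  WithLp.prod_inner_apply z w

theorem continuous_mk :
    Continuous fun p : EuclideanSpace ℝ (Fin n) × EuclideanSpace ℝ (Fin m) => mk p.1 p.2 :=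
  WithLp.prod_continuous_toLp 2 _ _

theorem norm_mk_sub_mk_le (x y : EuclideanSpace ℝ (Fin n)) (a b : EuclideanSpace ℝ (Fin m)) :
    ‖mk x a - mk y b‖ ≤ ‖x - y‖ + ‖a - b‖ :=
  norm_le_add _

end StateAction

open StateAction

/-! ### Admissible controls -/

/-- Pairing `a` with the fixed vector `w = a t - a s` reduces the claim to the fundamental theorem
of calculus for a scalar absolutely continuous function: `‖w‖² ≤ ‖w‖ L (t - s)`. -/
theorem LipschitzOnWith.of_ae_norm_deriv_le {F : Type*} [NormedAddCommGroup F]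
    [InnerProductSpace ℝ F] {a : ℝ → F} {L : ℝ} (hL : 0 ≤ L) {K : ℝ≥0}
    (ha : LipschitzOnWith K a (Ici 0))
    (hd : ∀ᵐ t ∂(volume.restrict (Ioi (0 : ℝ))), DifferentiableAt ℝ a t ∧ ‖deriv a t‖ ≤ L) :
    LipschitzOnWith L.toNNReal a (Ici 0) := by
  have key : ∀ s t : ℝ, 0 ≤ s → s ≤ t → ‖a t - a s‖ ≤ L * (t - s) := by
    intro s t hs hst
    set w := a t - a s with hw
    have hac : AbsolutelyContinuousOnInterval (fun τ => inner ℝ w (a τ)) s t := by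
      refine LipschitzOnWith.absolutelyContinuousOnInterval (K := ‖innerSL ℝ w‖₊ * K) ?_
      have h1 : LipschitzOnWith K a (uIcc s t) := ha.mono (by
        rw [uIcc_of_le hst]; exact fun τ hτ => hs.trans hτ.1)
      exact (innerSL ℝ w).lipschitz.comp_lipschitzOnWith h1
    have hftc := hac.integral_deriv_eq_sub
    have hae : ∀ᵐ τ, τ ∈ Ioc s t → deriv (fun τ => inner ℝ w (a τ)) τ ≤ ‖w‖ * L := by
      rw [ae_restrict_iff' measurableSet_Ioi] at hd
      filter_upwards [hd] with τ hτ hmem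
      obtain ⟨h1, h2⟩ := hτ (hs.trans_lt hmem.1)
      have h3 : HasDerivAt (fun τ => inner ℝ w (a τ)) (inner ℝ w (deriv a τ)) τ := 
        (innerSL ℝ w).hasFDerivAt.comp_hasDerivAt τ h1.hasDerivAt
      rw [h3.deriv]
      exact (real_inner_le_norm _ _).trans (by gcongr)
    have hle : (∫ τ in s..t, deriv (fun τ => inner ℝ w (a τ)) τ) ≤ ∫ _ in s..t, ‖w‖ * L := by
      refine intervalIntegral.integral_mono_ae_restrict hst hac.intervalIntegrable_deriv
        intervalIntegrable_const ?_
      have := (ae_restrict_iff' (measurableSet_Ioc (a := s) (b := t))).2 hae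
      rwa [restrict_Ioc_eq_restrict_Icc] at this
    rw [hftc, ← inner_sub_right, ← hw, real_inner_self_eq_norm_sq,
      intervalIntegral.integral_const, smul_eq_mul] at hle
    rcases (norm_nonneg w).eq_or_lt with h0 | h0
    · rw [← h0]; exact mul_nonneg hL (sub_nonneg.2 hst)
    · nlinarith
  refine LipschitzOnWith.of_dist_le_mul fun t ht s hs => ?_
  rw [Real.coe_toNNReal L hL, dist_eq_norm, Real.dist_eq]
  rcases le_total s t with h | h
  · rw [abs_of_nonneg (sub_nonneg.2 h)]; exact key s t hs h
  · rw [abs_sub_comm, abs_of_nonneg (sub_nonneg.2 h), norm_sub_rev]; exact key t s ht h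

theorem isAdmissibleControl_iff {m : ℕ} {L : ℝ} (hL : 0 ≤ L) {a : ℝ → EuclideanSpace ℝ (Fin m)} :
    IsAdmissibleControl L a ↔ LipschitzOnWith L.toNNReal a (Ici 0) := by
  refine ⟨fun ⟨⟨K, hK⟩, hd⟩ => hK.of_ae_norm_deriv_le hL hd, fun h => ⟨⟨_, h⟩, ?_⟩⟩
  have h1 : LipschitzOnWith L.toNNReal a (Ioi 0) := h.mono Ioi_subset_Ici_self
  filter_upwards [h1.ae_differentiableWithinAt measurableSet_Ioi (μ := volume),
    ae_restrict_mem measurableSet_Ioi] with t ht htm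
  refine ⟨ht.differentiableAt (Ioi_mem_nhds htm), ?_⟩
  simpa [hL] using norm_deriv_le_of_lipschitzOn (Ioi_mem_nhds htm) h1

/-! ### Trajectories -/

/-- `f` and `r` are bounded by `C` and `K`-Lipschitz, with a positive constant `K`. -/
structure IsBoundedLipschitz {n m : ℕ} (f : StateAction n m → EuclideanSpace ℝ (Fin n))
    (r : StateAction n m → ℝ) (C K : ℝ) : Prop where
  K_pos : 0 < K
  norm_f_le : ∀ z, ‖f z‖ ≤ C
  abs_r_le : ∀ z, |r z| ≤ C
  norm_f_sub_le : ∀ z w, ‖f z - f w‖ ≤ K * ‖z - w‖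
  abs_r_sub_le : ∀ z w, |r z - r w| ≤ K * ‖z - w‖

namespace IsBoundedLipschitz

variable {n m : ℕ} {f : StateAction n m → EuclideanSpace ℝ (Fin n)} {r : StateAction n m → ℝ}
  {C K : ℝ}

theorem C_nonneg (H : IsBoundedLipschitz f r C K) : 0 ≤ C := (abs_nonneg _).trans (H.abs_r_le 0)

theorem lipschitzWith_f (H : IsBoundedLipschitz f r C K) : LipschitzWith K.toNNReal f :=
  LipschitzWith.of_dist_le_mul fun z w => by
    simpa [dist_eq_norm, H.K_pos.le] using H.norm_f_sub_le z w

theorem continuous_f (H : IsBoundedLipschitz f r C K) : Continuous f := H.lipschitzWith_f.continuous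

theorem continuous_r (H : IsBoundedLipschitz f r C K) : Continuous r :=
  (LipschitzWith.of_dist_le_mul (K := K.toNNReal) fun z w => by
    simpa [dist_eq_norm, H.K_pos.le] using H.abs_r_sub_le z w).continuous

end IsBoundedLipschitz

theorem exists_of_bounded_lipschitz {n m : ℕ} {f : StateAction n m → EuclideanSpace ℝ (Fin n)}
    {r : StateAction n m → ℝ} (hf_bdd : ∃ C : ℝ, ∀ z, ‖f z‖ ≤ C) (hf_lip : ∃ K, LipschitzWith K f)
    (hr_bdd : ∃ C : ℝ, ∀ z, |r z| ≤ C) (hr_lip : ∃ K, LipschitzWith K r) :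
    ∃ C K, IsBoundedLipschitz f r C K := by
  obtain ⟨C₁, h₁⟩ := hf_bdd
  obtain ⟨K₁, h₂⟩ := hf_lip
  obtain ⟨C₂, h₃⟩ := hr_bdd
  obtain ⟨K₂, h₄⟩ := hr_lip
  -- The summand `1` makes the constant positive, as the exponential form of Gronwall's bound
  -- requires.
  refine ⟨max C₁ C₂, K₁ + K₂ + 1, by positivity, fun z => (h₁ z).trans (le_max_left _ _),
    fun z => (h₃ z).trans (le_max_right _ _), fun z w => ?_, fun z w => ?_⟩
  · have := h₂.dist_le_mul z w
    rw [dist_eq_norm, dist_eq_norm] at this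
    refine this.trans ?_
    gcongr
    linarith [K₂.2]
  · have := h₄.dist_le_mul z w
    rw [Real.dist_eq, dist_eq_norm] at this
    refine this.trans ?_
    gcongr
    linarith [K₁.2]

/-! ### Global solutions for bounded Lipschitz vector fields -/

section ODE

variable {X : Type*} [NormedAddCommGroup X] [NormedSpace ℝ X]

/-- Speed at most `C` keeps a solution on `[-N, N]` within distance `C * N` of `x₀`, so
Picard–Lindelöf covers the whole interval at once. Uniqueness glues the solutions for different `N`.
-/
theorem exists_forall_hasDerivAt_of_lipschitz_of_bounded [CompleteSpace X] {v : ℝ → X → X}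
    {K C : ℝ≥0} (hlip : ∀ t, LipschitzWith K (v t)) (hcont : ∀ x, Continuous fun t => v t x)
    (hbdd : ∀ t x, ‖v t x‖ ≤ C) (x₀ : X) :
    ∃ x : ℝ → X, x 0 = x₀ ∧ ∀ t, HasDerivAt x (v t (x t)) t := by
  have hex : ∀ N : ℕ, ∃ α : ℝ → X, α 0 = x₀ ∧
      ∀ t ∈ Ioo (-(N : ℝ)) N, HasDerivAt α (v t (α t)) t := by
    intro N
    have h0 : (0 : ℝ) ∈ Icc (-(N : ℝ)) N := by simp
    have hPL : IsPicardLindelof v (tmin := -(N : ℝ)) (tmax := N) ⟨0, h0⟩ x₀ (C * N) 0 C K :=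
      ⟨fun t _ => (hlip t).lipschitzOnWith, fun x _ => (hcont x).continuousOn,
        fun t _ x _ => hbdd t x, by simp⟩
    obtain ⟨α, h1, h2⟩ := hPL.exists_eq_forall_mem_Icc_hasDerivWithinAt₀
    exact ⟨α, h1, fun t ht => (h2 t (Ioo_subset_Icc_self ht)).hasDerivAt (Icc_mem_nhds ht.1 ht.2)⟩
  choose α hα0 hα using hex
  have huniq : ∀ N M : ℕ, N ≤ M → EqOn (α N) (α M) (Ioo (-(N : ℝ)) N) := by
    intro N M hNM
    have hNM' : (N : ℝ) ≤ M := by exact_mod_cast hNM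
    rcases N.eq_zero_or_pos with rfl | hN
    · simp
    have hN' : (0 : ℝ) < N := by exact_mod_cast hN
    exact ODE_solution_unique_of_mem_Ioo (s := fun _ => univ) (t₀ := 0)
      (fun t _ => (hlip t).lipschitzOnWith) (by simp [hN'])
      (fun t ht => ⟨hα N t ht, mem_univ _⟩)
      (fun t ht => ⟨hα M t ⟨by linarith [ht.1], by linarith [ht.2]⟩, mem_univ _⟩)
      (by rw [hα0, hα0])
  have hmem : ∀ t : ℝ, t ∈ Ioo (-((⌈|t|⌉₊ + 1 : ℕ) : ℝ)) ((⌈|t|⌉₊ + 1 : ℕ) : ℝ) := by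
    intro t
    rw [mem_Ioo, ← abs_lt]
    push_cast
    linarith [Nat.le_ceil |t|]
  have heq : ∀ (N : ℕ) (t : ℝ), t ∈ Ioo (-(N : ℝ)) N → α (⌈|t|⌉₊ + 1) t = α N t := by
    intro N t ht
    rcases le_total (⌈|t|⌉₊ + 1) N with h | h
    · exact huniq _ _ h (hmem t)
    · exact (huniq _ _ h ht).symm
  refine ⟨fun t => α (⌈|t|⌉₊ + 1) t, hα0 _, fun t => ?_⟩
  refine (hα _ t (hmem t)).congr_of_eventuallyEq ?_
  filter_upwards [Ioo_mem_nhds (hmem t).1 (hmem t).2] with s hs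
  exact heq _ s hs

end ODE

section Trajectory

variable {n m : ℕ} {f : StateAction n m → EuclideanSpace ℝ (Fin n)} {r : StateAction n m → ℝ}
  {C K : ℝ} {a b : ℝ → EuclideanSpace ℝ (Fin m)} {x₀ y₀ : EuclideanSpace ℝ (Fin n)}
  {x y : ℝ → EuclideanSpace ℝ (Fin n)}

theorem IsTrajectory.exists (H : IsBoundedLipschitz f r C K) (ha : ContinuousOn a (Ici 0))
    (x₀ : EuclideanSpace ℝ (Fin n)) : ∃ x, IsTrajectory f a x₀ x := by
  -- The control is frozen at `a 0` for negative times to obtain a vector field continuous on all of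
  -- `ℝ`.
  have hac : Continuous fun t => a (max t 0) :=
    ha.comp_continuous (by fun_prop) fun t => mem_Ici.2 (le_max_right _ _)
  obtain ⟨x, h0, hx⟩ := exists_forall_hasDerivAt_of_lipschitz_of_bounded
    (v := fun t y => f (StateAction.mk y (a (max t 0)))) (K := K.toNNReal) (C := C.toNNReal)
    (fun t => LipschitzWith.of_dist_le_mul fun y z => by
      rw [dist_eq_norm, dist_eq_norm, Real.coe_toNNReal _ H.K_pos.le]
      refine (H.norm_f_sub_le _ _).trans ?_
      gcongr
      · exact H.K_pos.le
      · simpa using norm_mk_sub_mk_le y z (a (max t 0)) (a (max t 0)))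
    (fun y => H.continuous_f.comp (continuous_mk.comp (continuous_const.prodMk hac)))
    (fun t y => by simpa [H.C_nonneg] using H.norm_f_le _) x₀
  refine ⟨x, fun t _ => (hx t).continuousAt.continuousWithinAt, h0, fun t ht => ?_⟩
  simpa [max_eq_left ht.le] using hx t

theorem IsTrajectory.continuousOn_mk (hx : IsTrajectory f a x₀ x) (ha : ContinuousOn a (Ici 0)) :
    ContinuousOn (fun t => StateAction.mk (x t) (a t)) (Ici 0) :=
  continuous_mk.comp_continuousOn (hx.continuousOn.prodMk ha)

theorem IsTrajectory.hasDerivWithinAt (hf : Continuous f) (hx : IsTrajectory f a x₀ x)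
    (ha : ContinuousOn a (Ici 0)) {t : ℝ} (ht : 0 ≤ t) :
    HasDerivWithinAt x (f (StateAction.mk (x t) (a t))) (Ici t) t := by
  have hc := hf.comp_continuousOn (hx.continuousOn_mk ha)
  rcases ht.eq_or_lt with rfl | ht
  · refine hasDerivWithinAt_Ici_of_tendsto_deriv (s := Ioi 0)
      (fun s hs => (hx.hasDerivAt s hs).differentiableAt.differentiableWithinAt)
      ((hx.continuousOn 0 self_mem_Ici).mono Ioi_subset_Ici_self) self_mem_nhdsWithin ?_
    have h1 := (hc 0 self_mem_Ici).mono_left (nhdsWithin_mono _ (Ioi_subset_Ici_self))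
    refine h1.congr' ?_
    filter_upwards [self_mem_nhdsWithin] with s hs
    exact (hx.hasDerivAt s hs).deriv.symm
  · exact (hx.hasDerivAt t ht).hasDerivWithinAt

/-- Gronwall with initial error `δ` and forcing `K δ` gives `δ e^{Kt} + δ (e^{Kt} - 1)`. -/
theorem IsTrajectory.norm_sub_le (H : IsBoundedLipschitz f r C K) (hx : IsTrajectory f a x₀ x)
    (hy : IsTrajectory f b y₀ y) (ha : ContinuousOn a (Ici 0)) (hb : ContinuousOn b (Ici 0))
    {δ T : ℝ} (hδ : 0 ≤ δ) (hxy : ‖x₀ - y₀‖ ≤ δ) (hab : ∀ t ∈ Ico 0 T, ‖a t - b t‖ ≤ δ) :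
    ∀ t ∈ Icc 0 T, ‖x t - y t‖ ≤ 2 * δ * Real.exp (K * t) := by
  intro t ht
  have h := norm_le_gronwallBound_of_norm_deriv_right_le (f := fun t => x t - y t)
    (f' := fun t => f (StateAction.mk (x t) (a t)) - f (StateAction.mk (y t) (b t))) (δ := δ) (K := K) (ε := K * δ)
    (a := 0) (b := T)
    ((hx.continuousOn.sub hy.continuousOn).mono Icc_subset_Ici_self)
    (fun s hs => (hx.hasDerivWithinAt H.continuous_f ha hs.1).sub
      (hy.hasDerivWithinAt H.continuous_f hb hs.1))
    (by simpa [hx.initial, hy.initial] using hxy)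
    (fun s hs => by
      refine (H.norm_f_sub_le _ _).trans ?_
      rw [← mul_add]
      have := H.K_pos.le
      gcongr
      exact (norm_mk_sub_mk_le _ _ _ _).trans (by linarith [hab s hs])) t ht
  rw [gronwallBound_of_K_ne_0 H.K_pos.ne'] at h
  have hK := H.K_pos.ne'
  have : K * δ / K = δ := by field_simp
  simp only [this, sub_zero] at h
  linarith

theorem IsTrajectory.eqOn (H : IsBoundedLipschitz f r C K) (hx : IsTrajectory f a x₀ x)
    (hy : IsTrajectory f b x₀ y) (ha : ContinuousOn a (Ici 0)) (hb : ContinuousOn b (Ici 0))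
    {T : ℝ} (hab : ∀ t ∈ Ico 0 T, a t = b t) : EqOn x y (Icc 0 T) := by
  intro t ht
  have := hx.norm_sub_le H hy ha hb le_rfl (T := T) (by simp) (fun s hs => by simp [hab s hs]) t ht
  simpa [sub_eq_zero] using this

theorem IsTrajectory.shift (hx : IsTrajectory f a x₀ x) {h : ℝ} (hh : 0 ≤ h) :
    IsTrajectory f (fun t => a (t + h)) (x h) (fun t => x (t + h)) where
  continuousOn := hx.continuousOn.comp (by fun_prop) fun t ht => add_nonneg ht hh
  initial := by simp
  hasDerivAt t ht := (hx.hasDerivAt (t + h) (by linarith)).comp_add_const t h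

/-- The mean value inequality for `x t - t • p`. Taking `p = f z` gives the first-order expansion of
the state, and `p = 0` the speed bound. -/
theorem IsTrajectory.norm_sub_sub_smul_le (H : IsBoundedLipschitz f r C K)
    (hx : IsTrajectory f a x₀ x) (ha : ContinuousOn a (Ici 0)) {D : ℝ}
    {p : EuclideanSpace ℝ (Fin n)} {h : ℝ} (hh : 0 ≤ h)
    (hD : ∀ t ∈ Ico 0 h, ‖f (StateAction.mk (x t) (a t)) - p‖ ≤ D) : ‖x h - x₀ - h • p‖ ≤ D * h := by
  have := norm_image_sub_le_of_norm_deriv_right_le_segment (f := fun t => x t - t • p)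
    (f' := fun t => f (StateAction.mk (x t) (a t)) - p) (C := D) (a := 0) (b := h)
    ((hx.continuousOn.mono Icc_subset_Ici_self).sub (by fun_prop))
    (fun s hs => (hx.hasDerivWithinAt H.continuous_f ha hs.1).sub
      (by simpa using (hasDerivWithinAt_id s (Ici s)).smul_const p)) hD h ⟨hh, le_rfl⟩
  simpa [hx.initial, sub_right_comm] using this

theorem IsTrajectory.norm_sub_initial_le (H : IsBoundedLipschitz f r C K)
    (hx : IsTrajectory f a x₀ x) (ha : ContinuousOn a (Ici 0)) {h : ℝ} (hh : 0 ≤ h) :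
    ‖x h - x₀‖ ≤ C * h := by
  simpa using hx.norm_sub_sub_smul_le H ha (p := 0) hh fun t _ => by simpa using H.norm_f_le _

end Trajectory

/-! ### Discounted rewards -/

section Reward

variable {n m : ℕ} {f : StateAction n m → EuclideanSpace ℝ (Fin n)} {r : StateAction n m → ℝ}
  {C K γ L : ℝ} {a b : ℝ → EuclideanSpace ℝ (Fin m)}
  {x y : ℝ → EuclideanSpace ℝ (Fin n)}

theorem continuousOn_discounted (hr : Continuous r) (hx : ContinuousOn x (Ici 0))
    (ha : ContinuousOn a (Ici 0)) :
    ContinuousOn (fun t => Real.exp (-γ * t) * r (mk (x t) (a t))) (Ici 0) :=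
  (Continuous.continuousOn (by fun_prop)).mul
    (hr.comp_continuousOn (continuous_mk.comp_continuousOn (hx.prodMk ha)))

theorem integrableOn_exp_neg_mul_mul (hγ : 0 < γ) (D : ℝ) :
    IntegrableOn (fun t => Real.exp (-γ * t) * D) (Ioi 0) :=
  (integrableOn_exp_mul_Ioi (neg_lt_zero.2 hγ) 0).mul_const D

theorem integrableOn_discounted (H : IsBoundedLipschitz f r C K) (hγ : 0 < γ)
    (hx : ContinuousOn x (Ici 0)) (ha : ContinuousOn a (Ici 0)) :
    IntegrableOn (fun t => Real.exp (-γ * t) * r (mk (x t) (a t))) (Ioi 0) := by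
  refine (integrableOn_exp_neg_mul_mul hγ C).mono'
    (((continuousOn_discounted H.continuous_r hx ha).mono
      Ioi_subset_Ici_self).aestronglyMeasurable measurableSet_Ioi) (Filter.Eventually.of_forall
        fun t => ?_)
  rw [norm_mul, Real.norm_eq_abs, Real.abs_exp]
  gcongr
  exact H.abs_r_le _

theorem abs_discountedReward_le (H : IsBoundedLipschitz f r C K) (hγ : 0 < γ) :
    |discountedReward r γ x a| ≤ C / γ := by
  have h := norm_integral_le_of_norm_le (integrableOn_exp_neg_mul_mul hγ C)
    (f := fun t => Real.exp (-γ * t) * r (mk (x t) (a t))) (Filter.Eventually.of_forall fun t => by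
      rw [norm_mul, Real.norm_eq_abs, Real.abs_exp]
      gcongr
      exact H.abs_r_le _)
  rw [integral_mul_const, integral_exp_mul_Ioi (neg_lt_zero.2 hγ)] at h
  simpa [discountedReward, div_eq_mul_inv, mul_comm] using h

theorem discountedReward_congr (hx : EqOn x y (Ioi 0)) (ha : EqOn a b (Ioi 0)) :
    discountedReward r γ x a = discountedReward r γ y b :=
  setIntegral_congr_fun measurableSet_Ioi fun t ht => by simp only [hx ht, ha ht]

theorem setIntegral_Ioi_comp_add_right (g : ℝ → ℝ) (h : ℝ) :
    ∫ t in Ioi 0, g (t + h) = ∫ t in Ioi h, g t := by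
  have := (measurePreserving_add_right volume h).setIntegral_preimage_emb
    (measurableEmbedding_addRight h) g (Ioi h)
  simpa using this

theorem discountedReward_eq_add_shift (H : IsBoundedLipschitz f r C K) (hγ : 0 < γ)
    (hx : ContinuousOn x (Ici 0)) (ha : ContinuousOn a (Ici 0)) {h : ℝ} (hh : 0 ≤ h) :
    discountedReward r γ x a = (∫ t in (0 : ℝ)..h, Real.exp (-γ * t) * r (mk (x t) (a t))) +
      Real.exp (-γ * h) * discountedReward r γ (fun t => x (t + h)) (fun t => a (t + h)) := by
  have hint := integrableOn_discounted H hγ hx ha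
  rw [discountedReward, ← intervalIntegral.integral_interval_add_Ioi hint
    (hint.mono_set (Ioi_subset_Ioi hh)), discountedReward, ← integral_const_mul,
    ← setIntegral_Ioi_comp_add_right]
  congr 1
  refine integral_congr_ae (Filter.Eventually.of_forall fun t => ?_)
  simp only [← mul_assoc, ← Real.exp_add]
  ring_nf

end Reward

/-! ### The Q-function -/

section Q

variable {n m : ℕ} {f : StateAction n m → EuclideanSpace ℝ (Fin n)} {r : StateAction n m → ℝ}
  {C K γ L : ℝ} {a b : ℝ → EuclideanSpace ℝ (Fin m)} {x₀ : EuclideanSpace ℝ (Fin n)}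
  {x : ℝ → EuclideanSpace ℝ (Fin n)} {z w : StateAction n m}

theorem IsAdmissibleControl.lipschitzOnWith (hL : 0 ≤ L) (ha : IsAdmissibleControl L a) :
    LipschitzOnWith L.toNNReal a (Ici 0) := (isAdmissibleControl_iff hL).1 ha

theorem IsAdmissibleControl.continuousOn (ha : IsAdmissibleControl L a) :
    ContinuousOn a (Ici 0) := ha.1.choose_spec.continuousOn

theorem IsAdmissibleControl.norm_sub_le (hL : 0 ≤ L) (ha : IsAdmissibleControl L a) {s t : ℝ}
    (hs : 0 ≤ s) (hst : s ≤ t) : ‖a t - a s‖ ≤ L * (t - s) := by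
  have := (ha.lipschitzOnWith hL).dist_le_mul t (hs.trans hst) s hs
  rwa [dist_eq_norm, Real.dist_eq, abs_of_nonneg (sub_nonneg.2 hst), Real.coe_toNNReal _ hL] at this

theorem isAdmissibleControl_of_norm_sub_le (hL : 0 ≤ L)
    (h : ∀ s t, 0 ≤ s → s ≤ t → ‖a t - a s‖ ≤ L * (t - s)) : IsAdmissibleControl L a := by
  refine (isAdmissibleControl_iff hL).2 (LipschitzOnWith.of_dist_le_mul fun t ht s hs => ?_)
  rw [Real.coe_toNNReal _ hL, dist_eq_norm, Real.dist_eq]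
  rcases le_total s t with hst | hst
  · rw [abs_of_nonneg (sub_nonneg.2 hst)]; exact h s t hs hst
  · rw [abs_sub_comm, abs_of_nonneg (sub_nonneg.2 hst), norm_sub_rev]; exact h t s ht hst

theorem IsAdmissibleControl.shift (hL : 0 ≤ L) (ha : IsAdmissibleControl L a) {h : ℝ}
    (hh : 0 ≤ h) : IsAdmissibleControl L fun t => a (t + h) :=
  isAdmissibleControl_of_norm_sub_le hL fun s t hs hst => by
    simpa using ha.norm_sub_le hL (add_nonneg hs hh) (by linarith : s + h ≤ t + h)

theorem IsAdmissibleControl.add_const (hL : 0 ≤ L) (ha : IsAdmissibleControl L a)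
    (c : EuclideanSpace ℝ (Fin m)) : IsAdmissibleControl L fun t => a t + c :=
  isAdmissibleControl_of_norm_sub_le hL fun s t hs hst => by
    simpa using ha.norm_sub_le hL hs hst

theorem isAdmissibleControl_add_smul (hL : 0 ≤ L) (c v : EuclideanSpace ℝ (Fin m))
    (hv : ‖v‖ ≤ L) : IsAdmissibleControl L fun t => c + t • v :=
  isAdmissibleControl_of_norm_sub_le hL fun s t _ hst => by
    rw [add_sub_add_left_eq_sub, ← sub_smul, norm_smul, Real.norm_of_nonneg (sub_nonneg.2 hst),
      mul_comm]
    exact mul_le_mul_of_nonneg_right hv (sub_nonneg.2 hst)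

/-- Following `a` up to time `h` and `b` afterwards is admissible. -/
theorem IsAdmissibleControl.concat (hL : 0 ≤ L) (ha : IsAdmissibleControl L a)
    (hb : IsAdmissibleControl L b) {h : ℝ} (hab : b 0 = a h) :
    IsAdmissibleControl L fun t => if t ≤ h then a t else b (t - h) := by
  refine isAdmissibleControl_of_norm_sub_le hL fun s t hs hst => ?_
  by_cases h1 : t ≤ h
  · simpa [h1, hst.trans h1] using ha.norm_sub_le hL hs hst
  · by_cases h2 : s ≤ h
    · simp only [h1, h2, if_true, if_false]
      have h3 := hb.norm_sub_le hL le_rfl (sub_nonneg.2 (not_le.1 h1).le)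
      have h4 := ha.norm_sub_le hL hs h2
      have h5 := norm_sub_le_norm_sub_add_norm_sub (b (t - h)) (a h) (a s)
      rw [hab] at h3
      linarith
    · simpa [h1, h2] using hb.norm_sub_le hL (sub_nonneg.2 (not_le.1 h2).le)
        (sub_le_sub_right hst h)

theorem attainableRewards_nonempty (H : IsBoundedLipschitz f r C K) (hL : 0 ≤ L) :
    (attainableRewards f r γ L z).Nonempty := by
  have ha := isAdmissibleControl_add_smul hL z.snd 0 (by simpa using hL)
  obtain ⟨x, hx⟩ := IsTrajectory.exists H ha.continuousOn z.fst
  exact ⟨_, _, x, ha, by simp, hx, rfl⟩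

theorem abs_le_of_mem_attainableRewards (H : IsBoundedLipschitz f r C K) (hγ : 0 < γ) {J : ℝ}
    (hJ : J ∈ attainableRewards f r γ L z) : |J| ≤ C / γ := by
  obtain ⟨a, x, -, -, -, rfl⟩ := hJ
  exact abs_discountedReward_le H hγ

theorem isLUB_optimalQ (H : IsBoundedLipschitz f r C K) (hγ : 0 < γ) (hL : 0 ≤ L)
    (z : StateAction n m) : IsLUB (attainableRewards f r γ L z) (optimalQ f r γ L z) :=
  isLUB_csSup (attainableRewards_nonempty H hL)
    ⟨C / γ, fun _ hJ => (abs_le.1 (abs_le_of_mem_attainableRewards H hγ hJ)).2⟩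

theorem abs_optimalQ_le (H : IsBoundedLipschitz f r C K) (hγ : 0 < γ) (hL : 0 ≤ L)
    (z : StateAction n m) : |optimalQ f r γ L z| ≤ C / γ := by
  obtain ⟨J, hJ⟩ := attainableRewards_nonempty (γ := γ) (z := z) H hL
  have h1 := abs_le.1 (abs_le_of_mem_attainableRewards H hγ hJ)
  exact abs_le.2 ⟨h1.1.trans ((isLUB_optimalQ H hγ hL z).1 hJ),
    (isLUB_optimalQ H hγ hL z).2 fun J hJ =>
      (abs_le.1 (abs_le_of_mem_attainableRewards H hγ hJ)).2⟩

/-- The modulus of continuity of the Q-function. -/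
noncomputable def rewardModulus (C K γ δ : ℝ) : ℝ :=
  ∫ t in Ioi (0 : ℝ), Real.exp (-γ * t) * min (2 * C) (K * (2 * |δ| * Real.exp (K * t) + |δ|))

theorem abs_rewardModulus_integrand_le (hC : 0 ≤ C) (hK : 0 < K) (δ t : ℝ) :
    ‖Real.exp (-γ * t) * min (2 * C) (K * (2 * |δ| * Real.exp (K * t) + |δ|))‖ ≤
      Real.exp (-γ * t) * (2 * C) := by
  rw [norm_mul, Real.norm_eq_abs, Real.abs_exp, Real.norm_eq_abs,
    abs_of_nonneg (le_min (by positivity) (by positivity))]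
  gcongr
  exact min_le_left _ _

/-- Dominated convergence. The cap `2 * C` keeps the integrand integrable even when `e^{Kt}`
outgrows `e^{γt}`. -/
theorem continuous_rewardModulus (hC : 0 ≤ C) (hK : 0 < K) (hγ : 0 < γ) :
    Continuous (rewardModulus C K γ) :=
  continuous_of_dominated (fun δ => (Continuous.aestronglyMeasurable (by fun_prop)))
    (fun δ => Filter.Eventually.of_forall fun t => abs_rewardModulus_integrand_le hC hK δ t)
    (integrableOn_exp_neg_mul_mul hγ _) (Filter.Eventually.of_forall fun t => by fun_prop)

theorem rewardModulus_zero (hC : 0 ≤ C) : rewardModulus C K γ 0 = 0 := by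
  simp [rewardModulus, hC]

/-- A control starting at `z.snd`, translated by a constant, starts at `w.snd` and stays within `‖z
- w‖` of the original; Gronwall controls the states. -/
theorem optimalQ_sub_le (H : IsBoundedLipschitz f r C K) (hγ : 0 < γ) (hL : 0 ≤ L)
    (z w : StateAction n m) :
    optimalQ f r γ L z - optimalQ f r γ L w ≤ rewardModulus C K γ ‖z - w‖ := by
  rw [sub_le_iff_le_add]
  refine (isLUB_optimalQ H hγ hL z).2 ?_
  rintro _ ⟨a, x, ha, ha0, hx, rfl⟩
  have hb := ha.add_const hL (w.snd - z.snd)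
  obtain ⟨y, hy⟩ := IsTrajectory.exists H hb.continuousOn w.fst
  have h1 := (isLUB_optimalQ H hγ hL w).1 ⟨_, y, hb, by simp [ha0], hy, rfl⟩
  refine le_trans ?_ (add_le_add_right h1 _)
  rw [← sub_le_iff_le_add, discountedReward, discountedReward, ← integral_sub
    (integrableOn_discounted H hγ hx.continuousOn ha.continuousOn)
    (integrableOn_discounted H hγ hy.continuousOn hb.continuousOn)]
  refine setIntegral_mono_on ((integrableOn_discounted H hγ hx.continuousOn ha.continuousOn).sub
    (integrableOn_discounted H hγ hy.continuousOn hb.continuousOn)) ?_ measurableSet_Ioi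
    fun t ht => ?_
  · exact (integrableOn_exp_neg_mul_mul hγ (2 * C)).mono'
      (Continuous.aestronglyMeasurable (by fun_prop))
      (Filter.Eventually.of_forall fun t => abs_rewardModulus_integrand_le H.C_nonneg H.K_pos _ t)
  · have hab : ∀ s, ‖a s - (a s + (w.snd - z.snd))‖ ≤ ‖z - w‖ := fun s => by
      simpa using norm_snd_le (z - w)
    have h2 := hx.norm_sub_le H hy ha.continuousOn hb.continuousOn (norm_nonneg (z - w))
      (norm_fst_le (z - w)) (fun s _ => hab s) (T := t) t ⟨(mem_Ioi.1 ht).le, le_rfl⟩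
    rw [← mul_sub, abs_norm]
    gcongr
    refine le_min ?_ ?_
    · have h3 := abs_le.1 (H.abs_r_le (mk (x t) (a t)))
      have h4 := abs_le.1 (H.abs_r_le (mk (y t) (a t + (w.snd - z.snd))))
      linarith [h3.2, h4.1]
    · refine (le_abs_self _).trans ((H.abs_r_sub_le _ _).trans ?_)
      have := H.K_pos.le
      gcongr
      exact (norm_mk_sub_mk_le _ _ _ _).trans (add_le_add h2 (hab t))

theorem continuous_optimalQ (H : IsBoundedLipschitz f r C K) (hγ : 0 < γ) (hL : 0 ≤ L) :
    Continuous (optimalQ f r γ L) := by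
  refine continuous_iff_continuousAt.2 fun z => ?_
  rw [ContinuousAt, tendsto_iff_norm_sub_tendsto_zero]
  have h : Filter.Tendsto (fun w => rewardModulus C K γ ‖w - z‖) (𝓝 z) (𝓝 0) := by
    have : Continuous fun w => rewardModulus C K γ ‖w - z‖ :=
      (continuous_rewardModulus H.C_nonneg H.K_pos hγ).comp (by fun_prop)
    simpa [rewardModulus_zero H.C_nonneg] using this.tendsto z
  refine squeeze_zero (fun _ => norm_nonneg _) (fun w => ?_) h
  refine abs_le.2 ⟨?_, optimalQ_sub_le H hγ hL w z⟩
  have := optimalQ_sub_le H hγ hL z w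
  rw [norm_sub_rev] at this
  linarith

/-! ### Dynamic programming -/

theorem discountedReward_le_add_optimalQ (H : IsBoundedLipschitz f r C K) (hγ : 0 < γ)
    (hL : 0 ≤ L) (ha : IsAdmissibleControl L a) (hx : IsTrajectory f a x₀ x) {h : ℝ}
    (hh : 0 ≤ h) :
    discountedReward r γ x a ≤ (∫ t in (0 : ℝ)..h, Real.exp (-γ * t) * r (mk (x t) (a t))) +
      Real.exp (-γ * h) * optimalQ f r γ L (mk (x h) (a h)) := by
  rw [discountedReward_eq_add_shift H hγ hx.continuousOn ha.continuousOn hh]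
  gcongr
  exact (isLUB_optimalQ H hγ hL _).1 ⟨_, _, ha.shift hL hh, by simp, hx.shift hh, rfl⟩

/-- Every competitor from the point reached at time `h` can be appended to `a`, which gives a
competitor from the initial point. -/
theorem add_optimalQ_le_optimalQ (H : IsBoundedLipschitz f r C K) (hγ : 0 < γ)
    (hL : 0 ≤ L) (ha : IsAdmissibleControl L a) (hx : IsTrajectory f a x₀ x) {h : ℝ}
    (hh : 0 ≤ h) :
    (∫ t in (0 : ℝ)..h, Real.exp (-γ * t) * r (mk (x t) (a t))) +
      Real.exp (-γ * h) * optimalQ f r γ L (mk (x h) (a h)) ≤ optimalQ f r γ L (mk x₀ (a 0)) := by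
  rw [← le_sub_iff_add_le', ← le_div_iff₀' (Real.exp_pos _)]
  refine (isLUB_optimalQ H hγ hL _).2 ?_
  rintro _ ⟨b, y, hb, hb0, hy, rfl⟩
  rw [le_div_iff₀' (Real.exp_pos _), le_sub_iff_add_le']
  have hc := ha.concat hL hb hb0
  set c := fun t => if t ≤ h then a t else b (t - h) with hcdef
  obtain ⟨X, hX⟩ := IsTrajectory.exists H hc.continuousOn x₀
  have hca : ∀ t ≤ h, c t = a t := fun t ht => by simp [hcdef, ht]
  have hcb : ∀ t, 0 ≤ t → c (t + h) = b t := fun t ht => by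
    rcases ht.eq_or_lt with rfl | ht
    · simpa [hcdef] using hb0.symm
    · simp [hcdef, ht]
  have hXx : EqOn X x (Icc 0 h) := hX.eqOn H hx hc.continuousOn ha.continuousOn
    fun t ht => hca t ht.2.le
  have hXs := hX.shift hh
  rw [hXx ⟨hh, le_rfl⟩] at hXs
  have hXy : ∀ t, 0 ≤ t → X (t + h) = y t := fun t ht =>
    hXs.eqOn H hy (hc.shift hL hh).continuousOn hb.continuousOn (fun s hs => hcb s hs.1)
      (T := t) ⟨ht, le_rfl⟩
  refine le_of_eq_of_le ?_ ((isLUB_optimalQ H hγ hL _).1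
    ⟨c, X, hc, hca 0 hh, hX, rfl⟩)
  rw [discountedReward_eq_add_shift H hγ hX.continuousOn hc.continuousOn hh]
  congr 1
  · refine intervalIntegral.integral_congr fun t ht => ?_
    rw [uIcc_of_le hh] at ht
    simp only [hXx ht, hca t ht.2]
  · congr 1
    exact (discountedReward_congr (fun t ht => hXy t (mem_Ioi.1 ht).le)
      fun t ht => hcb t (mem_Ioi.1 ht).le).symm

end Q

/-! ### The Q-function is a viscosity solution -/

/-- Divide by `h` and let `h → 0⁺`. It serves with `q = Q` for the subsolution and `q = -Q` for the
supersolution inequality. -/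
theorem mul_le_add_of_eventually_le {γ q R A B D : ℝ}
    (h : ∀ᶠ h in 𝓝[>] (0 : ℝ), q * (1 - Real.exp (-γ * h)) ≤
      h * R + D * h ^ 2 + Real.exp (-γ * h) * (h * A + B * h ^ 2)) : γ * q ≤ R + A := by
  have h1 : Filter.Tendsto (fun h : ℝ => q * ((1 - Real.exp (-γ * h)) / h)) (𝓝[>] 0)
      (𝓝 (q * γ)) := by
    have hd : HasDerivAt (fun h : ℝ => 1 - Real.exp (-γ * h)) γ 0 := by
      have := (((hasDerivAt_id (0 : ℝ)).const_mul (-γ)).exp).const_sub 1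
      simpa using this
    have := (hasDerivAt_iff_tendsto_slope_zero.1 hd).mono_left
      (nhdsWithin_mono _ fun t (ht : t ∈ Ioi (0 : ℝ)) => (mem_Ioi.1 ht).ne')
    simp only [zero_add, mul_zero, Real.exp_zero, sub_self, sub_zero, smul_eq_mul] at this
    simpa [div_eq_inv_mul] using this.const_mul q
  have h2 : Filter.Tendsto (fun h : ℝ => R + D * h + Real.exp (-γ * h) * (A + B * h)) (𝓝[>] 0)
      (𝓝 (R + A)) := by
    have : Continuous fun h : ℝ => R + D * h + Real.exp (-γ * h) * (A + B * h) := by fun_prop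
    simpa using (this.tendsto 0).mono_left nhdsWithin_le_nhds
  rw [mul_comm]
  refine le_of_tendsto_of_tendsto h1 h2 ?_
  filter_upwards [h, self_mem_nhdsWithin] with t ht ht0
  rw [← mul_div_assoc, div_le_iff₀ (mem_Ioi.1 ht0)]
  linarith

/-! ### Short-time expansions, uniform over controls -/

section ShortTime

variable {n m : ℕ} {f : StateAction n m → EuclideanSpace ℝ (Fin n)} {r : StateAction n m → ℝ}
  {C K γ L : ℝ} {a : ℝ → EuclideanSpace ℝ (Fin m)} {z : StateAction n m}
  {x : ℝ → EuclideanSpace ℝ (Fin n)}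

theorem IsTrajectory.norm_mk_sub_le (H : IsBoundedLipschitz f r C K) (hL : 0 ≤ L)
    (ha : IsAdmissibleControl L a) (ha0 : a 0 = z.snd) (hx : IsTrajectory f a z.fst x) {h : ℝ}
    (hh : 0 ≤ h) : ‖StateAction.mk (x h) (a h) - z‖ ≤ (C + L) * h := by
  have h1 := hx.norm_sub_initial_le H ha.continuousOn hh
  have h2 := ha.norm_sub_le hL le_rfl hh
  have h3 := norm_mk_sub_mk_le (x h) z.fst (a h) z.snd
  rw [mk_fst_snd] at h3
  rw [ha0, sub_zero] at h2
  linarith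

theorem IsTrajectory.abs_integral_sub_le (H : IsBoundedLipschitz f r C K) (hγ : 0 < γ)
    (hL : 0 ≤ L) (ha : IsAdmissibleControl L a) (ha0 : a 0 = z.snd)
    (hx : IsTrajectory f a z.fst x) {h : ℝ} (hh : 0 ≤ h) :
    |(∫ t in (0 : ℝ)..h, Real.exp (-γ * t) * r (StateAction.mk (x t) (a t))) - h * r z| ≤
      (γ * C + K * (C + L)) * h ^ 2 := by
  have hint : IntervalIntegrable
      (fun t => Real.exp (-γ * t) * r (StateAction.mk (x t) (a t))) volume 0 h :=
    ((continuousOn_discounted H.continuous_r hx.continuousOn ha.continuousOn).mono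
      Icc_subset_Ici_self).intervalIntegrable_of_Icc hh
  have h1 : h * r z = ∫ _ in (0 : ℝ)..h, r z := by simp
  rw [h1, ← intervalIntegral.integral_sub hint intervalIntegrable_const]
  have h2 := intervalIntegral.norm_integral_le_of_norm_le_const (a := 0) (b := h)
    (f := fun t => Real.exp (-γ * t) * r (StateAction.mk (x t) (a t)) - r z)
    (C := (γ * C + K * (C + L)) * h) fun t ht => ?_
  · rw [sub_zero, abs_of_nonneg hh, Real.norm_eq_abs] at h2
    exact h2.trans_eq (by ring)
  rw [uIoc_of_le hh] at ht
  have hK := H.K_pos.le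
  have hC := H.C_nonneg
  have h3 : |r (StateAction.mk (x t) (a t)) - r z| ≤ K * ((C + L) * t) :=
    (H.abs_r_sub_le _ _).trans (by gcongr; exact hx.norm_mk_sub_le H hL ha ha0 ht.1.le)
  have h4 : |Real.exp (-γ * t) - 1| ≤ γ * t := by
    rw [abs_sub_comm, abs_of_nonneg (sub_nonneg.2 (Real.exp_le_one_iff.2 (by nlinarith [ht.1])))]
    linarith [Real.add_one_le_exp (-γ * t)]
  calc ‖Real.exp (-γ * t) * r (StateAction.mk (x t) (a t)) - r z‖
      = |(Real.exp (-γ * t) - 1) * r (StateAction.mk (x t) (a t)) +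
          (r (StateAction.mk (x t) (a t)) - r z)| := by
        rw [Real.norm_eq_abs]
        ring_nf
    _ ≤ |Real.exp (-γ * t) - 1| * |r (StateAction.mk (x t) (a t))| +
          |r (StateAction.mk (x t) (a t)) - r z| := by
        rw [← abs_mul]
        exact abs_add_le _ _
    _ ≤ γ * t * C + K * ((C + L) * t) := by
        gcongr
        · exact mul_nonneg hγ.le ht.1.le
        · exact H.abs_r_le _
    _ = (γ * C + K * (C + L)) * t := by ring
    _ ≤ (γ * C + K * (C + L)) * h := by
        gcongr
        exact ht.2

/-- Only the state is expanded. The action increment is kept exact, since a control need not have a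
derivative at time `0`. -/
theorem IsTrajectory.abs_inner_sub_le (H : IsBoundedLipschitz f r C K)
    (hL : 0 ≤ L) (ha : IsAdmissibleControl L a) (ha0 : a 0 = z.snd)
    (hx : IsTrajectory f a z.fst x) (p : StateAction n m) {h : ℝ} (hh : 0 ≤ h) :
    |inner ℝ p (StateAction.mk (x h) (a h) - z) - (h * inner ℝ p.fst (f z) +
      inner ℝ p.snd (a h - z.snd))| ≤ ‖p.fst‖ * (K * (C + L)) * h ^ 2 := by
  have hK := H.K_pos.le
  have hC := H.C_nonneg
  have h1 := hx.norm_sub_sub_smul_le H ha.continuousOn (p := f z) (D := K * ((C + L) * h)) hh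
    fun t ht => (H.norm_f_sub_le _ _).trans (by
      gcongr
      exact (hx.norm_mk_sub_le H hL ha ha0 ht.1).trans (by gcongr; exact ht.2.le))
  have h2 : inner ℝ p (StateAction.mk (x h) (a h) - z) - (h * inner ℝ p.fst (f z) +
      inner ℝ p.snd (a h - z.snd)) = inner ℝ p.fst (x h - z.fst - h • f z) := by
    have h3 : (StateAction.mk (x h) (a h) - z).fst = x h - z.fst := rfl
    have h4 : (StateAction.mk (x h) (a h) - z).snd = a h - z.snd := rfl
    rw [inner_eq, h3, h4, inner_sub_right p.fst (x h - z.fst), real_inner_smul_right]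
    ring
  rw [h2]
  refine (abs_real_inner_le_norm _ _).trans ?_
  calc ‖p.fst‖ * ‖x h - z.fst - h • f z‖ ≤ ‖p.fst‖ * (K * ((C + L) * h) * h) := by gcongr
    _ = _ := by ring

end ShortTime

/-! ### Sub- and supersolution inequalities -/

section Viscosity

variable {n m : ℕ} {f : StateAction n m → EuclideanSpace ℝ (Fin n)} {r : StateAction n m → ℝ}
  {C K γ L : ℝ} {φ : StateAction n m → ℝ} {z : StateAction n m}

theorem eventually_abs_sub_inner_gradient_le {E : Type*} [NormedAddCommGroup E]
    [InnerProductSpace ℝ E] [CompleteSpace E] {φ : E → ℝ} {z : E} (hφ : DifferentiableAt ℝ φ z)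
    {ε : ℝ} (hε : 0 < ε) :
    ∀ᶠ y in 𝓝 z, |φ y - φ z - inner ℝ (gradient φ z) (y - z)| ≤ ε * ‖y - z‖ :=
  (hasGradientAt_iff_isLittleO.1 hφ.hasGradientAt).def hε

/-- A property that holds near `z` holds along all controlled paths from `z` for short times. -/
theorem eventually_forall_norm_sub_le {E : Type*} [NormedAddCommGroup E] {P : E → Prop} {z : E}
    (hP : ∀ᶠ y in 𝓝 z, P y) (D : ℝ) :
    ∀ᶠ h in 𝓝[>] (0 : ℝ), ∀ y, ‖y - z‖ ≤ D * h → P y := by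
  obtain ⟨ε, hε, hball⟩ := Metric.eventually_nhds_iff.1 hP
  have h1 : ∀ᶠ h in 𝓝 (0 : ℝ), D * h < ε :=
    (by fun_prop : Continuous fun h : ℝ => D * h).continuousAt.eventually_lt continuousAt_const
      (by simpa using hε)
  filter_upwards [nhdsWithin_le_nhds h1] with h hh y hy
  exact hball (by rw [dist_eq_norm]; exact hy.trans_lt hh)

theorem hjbFunction_optimalQ_le_zero (H : IsBoundedLipschitz f r C K) (hγ : 0 < γ) (hL : 0 ≤ L)
    (hφ : DifferentiableAt ℝ φ z) (hmax : IsLocalMax (fun y => optimalQ f r γ L y - φ y) z) :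
    hjbFunction f r γ L z (optimalQ f r γ L z) (gradient φ z) ≤ 0 := by
  set p := gradient φ z
  have hCL : 0 ≤ C + L := add_nonneg H.C_nonneg hL
  have key : ∀ ε > 0, γ * optimalQ f r γ L z ≤
      (r z + ε) + (inner ℝ p.fst (f z) + L * ‖p.snd‖ + ε * (C + L)) := by
    intro ε hε
    refine mul_le_add_of_eventually_le (D := γ * C + K * (C + L))
      (B := ‖p.fst‖ * (K * (C + L))) ?_
    filter_upwards [eventually_forall_norm_sub_le (hmax.and
      (eventually_abs_sub_inner_gradient_le hφ hε)) (C + L), self_mem_nhdsWithin] with h hnear hh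
    have hh : 0 < h := hh
    -- The control is optimal up to `ε h`, an error that survives division by `h` only as `ε`. It
    -- depends on `h`, hence the need for uniform estimates.
    obtain ⟨_, ⟨a, x, ha, ha0, hx, rfl⟩, hJ, -⟩ :=
      (isLUB_optimalQ H hγ hL z).exists_between (sub_lt_self _ (mul_pos hε hh))
    have h1 := discountedReward_le_add_optimalQ H hγ hL ha hx hh.le
    have h2 := (abs_le.1 (hx.abs_integral_sub_le H hγ hL ha ha0 hh.le)).2
    have h3 := (abs_le.1 (hx.abs_inner_sub_le H hL ha ha0 p hh.le)).2
    have h4 := hx.norm_mk_sub_le H hL ha ha0 hh.le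
    obtain ⟨h5, h6⟩ := hnear _ h4
    have h6 := (abs_le.1 h6).2
    have h7 : inner ℝ p.snd (a h - z.snd) ≤ ‖p.snd‖ * (L * h) := by
      refine (real_inner_le_norm _ _).trans ?_
      have := ha.norm_sub_le hL le_rfl hh.le
      rw [ha0, sub_zero] at this
      gcongr
    have h8 : ε * ‖mk (x h) (a h) - z‖ ≤ ε * ((C + L) * h) := by gcongr
    have h9 : optimalQ f r γ L (mk (x h) (a h)) ≤ optimalQ f r γ L z +
        (h * (inner ℝ p.fst (f z) + L * ‖p.snd‖ + ε * (C + L)) +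
          ‖p.fst‖ * (K * (C + L)) * h ^ 2) := by
      linarith
    have h10 := mul_le_mul_of_nonneg_left h9 (Real.exp_pos (-γ * h)).le
    rw [mul_add] at h10
    linarith
  rw [hjbFunction]
  refine le_of_forall_pos_le_add fun ε hε => ?_
  have hpos : 0 < 1 + (C + L) := by linarith
  have h1 := key (ε / (1 + (C + L))) (div_pos hε hpos)
  have h2 : ε / (1 + (C + L)) + ε / (1 + (C + L)) * (C + L) = ε := by field_simp
  linarith

theorem zero_le_hjbFunction_optimalQ (H : IsBoundedLipschitz f r C K) (hγ : 0 < γ) (hL : 0 ≤ L)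
    (hφ : DifferentiableAt ℝ φ z) (hmin : IsLocalMin (fun y => optimalQ f r γ L y - φ y) z) :
    0 ≤ hjbFunction f r γ L z (optimalQ f r γ L z) (gradient φ z) := by
  set p := gradient φ z
  have hCL : 0 ≤ C + L := add_nonneg H.C_nonneg hL
  -- The maximizer of `inner ℝ p.snd v` over `‖v‖ ≤ L`; as `0⁻¹ = 0`, it is `0` when `p.snd = 0`.
  set v := (L * ‖p.snd‖⁻¹) • p.snd with hv
  have hvL : ‖v‖ ≤ L := by
    rw [hv, norm_smul, norm_mul, norm_inv, norm_norm, Real.norm_of_nonneg hL, mul_assoc]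
    exact mul_le_of_le_one_right hL (inv_mul_le_one_of_le₀ le_rfl (norm_nonneg _))
  have hpv : inner ℝ p.snd v = L * ‖p.snd‖ := by
    rw [hv, real_inner_smul_right, real_inner_self_eq_norm_sq]
    rcases eq_or_ne ‖p.snd‖ 0 with h | h
    · simp [h]
    · field_simp
  have ha := isAdmissibleControl_add_smul hL z.snd v hvL
  obtain ⟨x, hx⟩ := IsTrajectory.exists H ha.continuousOn z.fst
  have ha0 : z.snd + (0 : ℝ) • v = z.snd := by simp
  have key : ∀ ε > 0, γ * -optimalQ f r γ L z ≤
      -r z + (-inner ℝ p.fst (f z) - L * ‖p.snd‖ + ε * (C + L)) := by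
    intro ε hε
    refine mul_le_add_of_eventually_le (D := γ * C + K * (C + L))
      (B := ‖p.fst‖ * (K * (C + L))) ?_
    filter_upwards [eventually_forall_norm_sub_le (hmin.and
      (eventually_abs_sub_inner_gradient_le hφ hε)) (C + L), self_mem_nhdsWithin] with h hnear hh
    have hh : 0 < h := hh
    have h1 := add_optimalQ_le_optimalQ H hγ hL ha hx hh.le
    simp only [ha0, mk_fst_snd] at h1
    have h2 := (abs_le.1 (hx.abs_integral_sub_le H hγ hL ha ha0 hh.le)).1
    have h3 := (abs_le.1 (hx.abs_inner_sub_le H hL ha ha0 p hh.le)).1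
    have h4 := hx.norm_mk_sub_le H hL ha ha0 hh.le
    obtain ⟨h5, h6⟩ := hnear _ h4
    have h6 := (abs_le.1 h6).1
    rw [add_sub_cancel_left, real_inner_smul_right, hpv] at h3
    have h8 : ε * ‖mk (x h) (z.snd + h • v) - z‖ ≤ ε * ((C + L) * h) := by gcongr
    have h9 : -optimalQ f r γ L (mk (x h) (z.snd + h • v)) ≤ -optimalQ f r γ L z +
        (h * (-inner ℝ p.fst (f z) - L * ‖p.snd‖ + ε * (C + L)) +
          ‖p.fst‖ * (K * (C + L)) * h ^ 2) := by
      linarith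
    have h10 := mul_le_mul_of_nonneg_left h9 (Real.exp_pos (-γ * h)).le
    rw [mul_add] at h10
    linarith
  rw [hjbFunction]
  refine le_of_forall_pos_le_add fun ε hε => ?_
  have hpos : 0 < 1 + (C + L) := by linarith
  have h1 := key (ε / (1 + (C + L))) (div_pos hε hpos)
  have h2 : ε / (1 + (C + L)) + ε / (1 + (C + L)) * (C + L) = ε := by field_simp
  have h3 := div_pos hε hpos
  linarith

theorem isViscositySolution_optimalQ (H : IsBoundedLipschitz f r C K) (hγ : 0 < γ) (hL : 0 ≤ L) :
    IsViscositySolution (hjbFunction f r γ L) (optimalQ f r γ L) where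
  continuous := continuous_optimalQ H hγ hL
  subsolution _ _ hφ hmax :=
    hjbFunction_optimalQ_le_zero H hγ hL (hφ.differentiable one_ne_zero _) hmax
  supersolution _ _ hφ hmin :=
    zero_le_hjbFunction_optimalQ H hγ hL (hφ.differentiable one_ne_zero _) hmin

end Viscosity

/-! ### Comparison principle -/

/-- Among the maximizers of `G - c * d` there are ones with a small penalty `c * d`. -/
theorem exists_maximizer_penalty_le {X : Type*} {G d : X → ℝ} {x₀ : X} (hd₀ : d x₀ = 0)
    (hex : ∀ c : ℝ, 1 ≤ c → ∃ x, ∀ y, G y - c * d y ≤ G x - c * d x) {η : ℝ} (hη : 0 < η) :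
    ∃ c : ℝ, 1 ≤ c ∧ ∃ x, (∀ y, G y - c * d y ≤ G x - c * d x) ∧ c * d x ≤ η := by
  have hpow : ∀ k : ℕ, (1 : ℝ) ≤ 2 ^ k := fun k => one_le_pow₀ (by norm_num)
  choose x hx using fun k : ℕ => hex (2 ^ k) (hpow k)
  -- If all penalties exceeded `η`, each doubling of `c` would lower the maximum `S k` by at least
  -- `η / 2`, although it stays above `G x₀`.
  set S : ℕ → ℝ := fun k => G (x k) - 2 ^ k * d (x k) with hS
  have hstep : ∀ k, 2 ^ (k + 1) * d (x (k + 1)) ≤ 2 * (S k - S (k + 1)) := fun k => by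
    have := hx k (x (k + 1))
    simp only [hS, pow_succ]
    linarith
  by_contra! hcon
  have hgap : ∀ k, S (k + 1) ≤ S k - η / 2 := fun k => by
    linarith [hstep k, hcon _ (hpow (k + 1)) _ (hx (k + 1))]
  have hlin : ∀ k : ℕ, S k ≤ S 0 - k * (η / 2) := fun k => by
    induction k with
    | zero => simp
    | succ k ih => push_cast; linarith [hgap k]
  have hlow : ∀ k, G x₀ ≤ S k := fun k => by simpa [hd₀] using hx k x₀
  obtain ⟨N, hN⟩ := exists_nat_gt ((S 0 - G x₀) / (η / 2))
  rw [div_lt_iff₀ (by positivity)] at hN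
  linarith [hlin N, hlow N]

section Comparison

variable {E : Type*} [NormedAddCommGroup E] [InnerProductSpace ℝ E]

theorem exists_maximizer_doubling [FiniteDimensional ℝ E] {u v : E → ℝ} (hu : Continuous u)
    (hv : Continuous v) {B : ℝ} (hub : ∀ z, |u z| ≤ B) (hvb : ∀ z, |v z| ≤ B) {b c : ℝ}
    (hb : 0 < b) (hc : 0 < c) :
    ∃ p : E × E, ∀ q : E × E, u q.1 - v q.2 - b * ‖q.1‖ ^ 2 - c * ‖q.1 - q.2‖ ^ 2 ≤
      u p.1 - v p.2 - b * ‖p.1‖ ^ 2 - c * ‖p.1 - p.2‖ ^ 2 := by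
  have : ProperSpace E := FiniteDimensional.proper_real E
  have hB : 0 ≤ B := (abs_nonneg _).trans (hub 0)
  have hcont : Continuous fun q : E × E =>
      u q.1 - v q.2 - b * ‖q.1‖ ^ 2 - c * ‖q.1 - q.2‖ ^ 2 := by fun_prop
  refine hcont.exists_forall_ge' (0, 0) ?_
  -- The value at the origin is at least `-2B`, so a penalty of `4B` suffices. The `1` ensures `ρ ≤
  -- ρ ^ 2` for `ρ > R`.
  set R : ℝ := 4 * B / b + 4 * B / c + 1 with hR
  have h1 : 0 ≤ 4 * B / b := by positivity
  have h2 : 0 ≤ 4 * B / c := by positivity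
  have hbR : ∀ ρ, R < ρ → 4 * B ≤ b * ρ ^ 2 := fun ρ hρ => by
    have : 4 * B / b ≤ ρ ^ 2 := by nlinarith
    rwa [div_le_iff₀' hb] at this
  have hcR : ∀ ρ, R < ρ → 4 * B ≤ c * ρ ^ 2 := fun ρ hρ => by
    have : 4 * B / c ≤ ρ ^ 2 := by nlinarith
    rwa [div_le_iff₀' hc] at this
  filter_upwards [((isCompact_closedBall (0 : E) R).prod
    (isCompact_closedBall (0 : E) (2 * R))).compl_mem_cocompact] with q hq
  have hu1 := abs_le.1 (hub q.1)
  have hu2 := abs_le.1 (hub 0)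
  have hv1 := abs_le.1 (hvb q.2)
  have hv2 := abs_le.1 (hvb 0)
  have hpos1 : 0 ≤ b * ‖q.1‖ ^ 2 := by positivity
  have hpos2 : 0 ≤ c * ‖q.1 - q.2‖ ^ 2 := by positivity
  simp only [norm_zero, sub_self, ne_eq, OfNat.ofNat_ne_zero, not_false_eq_true, zero_pow,
    mul_zero, sub_zero]
  rcases lt_or_ge R ‖q.1‖ with h | h
  · linarith [hbR _ h]
  · have h3 : 2 * R < ‖q.2‖ := by
      by_contra! h4
      exact hq ⟨by simpa using h, by simpa using h4⟩
    have h4 : ‖q.2‖ ≤ ‖q.1‖ + ‖q.1 - q.2‖ := by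
      have := norm_sub_le q.1 (q.1 - q.2)
      rwa [sub_sub_cancel] at this
    linarith [hcR ‖q.1 - q.2‖ (by linarith)]

theorem contDiff_mul_norm_sub_sq (c : ℝ) (w : E) : ContDiff ℝ 1 fun y => c * ‖y - w‖ ^ 2 :=
  contDiff_const.mul ((contDiff_id.sub contDiff_const).norm_sq ℝ)

variable [CompleteSpace E]

theorem hasGradientAt_mul_norm_sub_sq (c : ℝ) (w z : E) :
    HasGradientAt (fun y => c * ‖y - w‖ ^ 2) ((2 * c) • (z - w)) z := by
  rw [hasGradientAt_iff_hasFDerivAt]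
  have h := ((hasFDerivAt_id z).sub_const w).norm_sq.const_mul c
  refine HasFDerivAt.congr_fderiv h (ContinuousLinearMap.ext fun y => ?_)
  simp only [id_eq, ContinuousLinearMap.comp_id, smul_eq_mul, smul_apply,
    innerSL_apply_apply, InnerProductSpace.toDual_apply_apply, real_inner_smul_left, nsmul_eq_mul]
  push_cast
  ring

theorem HasGradientAt.add_real {φ ψ : E → ℝ} {p q z : E} (hφ : HasGradientAt φ p z)
    (hψ : HasGradientAt ψ q z) : HasGradientAt (fun y => φ y + ψ y) (p + q) z := by
  rw [hasGradientAt_iff_hasFDerivAt] at *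
  rw [map_add]
  exact hφ.add hψ

/-- **Comparison principle** for bounded viscosity sub- and supersolutions of a Hamilton-Jacobi
equation with a strictly monotone dependence on the unknown function. -/
theorem IsViscositySolution.le_of_isViscositySolution [FiniteDimensional ℝ E]
    {F : E → ℝ → E → ℝ} {γ K M : ℝ} (hγ : 0 < γ) (hK : 0 ≤ K) (hM : 0 ≤ M)
    (hF : ∀ z w q q' p p', γ * (q - q') ≤
      F z q (p + p') - F w q' p + K * (‖p‖ + 1) * ‖z - w‖ + M * ‖p'‖)
    {u v : E → ℝ} (hu : IsViscositySolution F u) (hv : IsViscositySolution F v) {B : ℝ}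
    (hub : ∀ z, |u z| ≤ B) (hvb : ∀ z, |v z| ≤ B) (z₀ : E) : u z₀ ≤ v z₀ := by
  have hB : 0 ≤ B := (abs_nonneg _).trans (hub 0)
  have key : ∀ s > 0, γ * (u z₀ - v z₀) ≤ γ * (s ^ 2 * ‖z₀‖ ^ 2) + K * (2 * s ^ 2 + s) +
      M * (2 * s * (2 * B + 1 + s ^ 2 * ‖z₀‖ ^ 2)) := by
    intro s hs
    obtain ⟨c, hc, ⟨z, w⟩, hmax, hpen⟩ := exists_maximizer_penalty_le
      (G := fun q : E × E => u q.1 - v q.2 - s ^ 2 * ‖q.1‖ ^ 2)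
      (d := fun q : E × E => ‖q.1 - q.2‖ ^ 2) (x₀ := (0, 0)) (by simp)
      (fun c hc => exists_maximizer_doubling hu.continuous hv.continuous hub hvb
        (pow_pos hs 2) (by linarith)) (pow_pos hs 2)
    simp only at hmax hpen
    -- With one variable frozen, the penalties are test functions in the other. Both have the
    -- gradient part `2c (z - w)`, the `p` of `hF`; the localization adds `p' = 2s² z`.
    have hsub := hu.subsolution (fun y => c * ‖y - w‖ ^ 2 + s ^ 2 * ‖y - 0‖ ^ 2) z
      ((contDiff_mul_norm_sub_sq c w).add (contDiff_mul_norm_sub_sq (s ^ 2) 0))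
      (Filter.Eventually.of_forall fun y => by
        have := hmax (y, w)
        simp only [sub_zero] at this ⊢
        linarith)
    have hsup := hv.supersolution (fun y => -c * ‖y - z‖ ^ 2) w
      (contDiff_mul_norm_sub_sq (-c) z) (Filter.Eventually.of_forall fun y => by
        have := hmax (z, y)
        simp only [norm_sub_rev z] at this ⊢
        linarith)
    rw [((hasGradientAt_mul_norm_sub_sq c w z).add_real
      (hasGradientAt_mul_norm_sub_sq (s ^ 2) 0 z)).gradient] at hsub
    have hp : (2 * -c) • (w - z) = (2 * c) • (z - w) := by
      rw [← neg_sub z w, smul_neg, mul_neg, neg_smul, neg_neg]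
    rw [(hasGradientAt_mul_norm_sub_sq (-c) z w).gradient, hp] at hsup
    have hmain := hF z w (u z) (v w) ((2 * c) • (z - w)) ((2 * s ^ 2) • (z - 0))
    rw [norm_smul, norm_smul, Real.norm_of_nonneg (by positivity : 0 ≤ 2 * c),
      Real.norm_of_nonneg (by positivity : 0 ≤ 2 * s ^ 2), sub_zero] at hmain
    rw [sub_zero] at hsub
    have hz₀ := hmax (z₀, z₀)
    simp only [sub_self, norm_zero, ne_eq, OfNat.ofNat_ne_zero, not_false_eq_true, zero_pow,
      mul_zero, sub_zero] at hz₀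
    have hcd : 0 ≤ c * ‖z - w‖ ^ 2 := by positivity
    have hd : ‖z - w‖ ≤ s := by
      refine abs_le_of_sq_le_sq' ?_ hs.le |>.2
      nlinarith [sq_nonneg ‖z - w‖]
    -- Comparing with the pair `(z₀, z₀)` bounds `s ‖z‖` for fixed `z₀` as `s → 0`, so `2 s² ‖z‖ =
    -- 2s (s ‖z‖)` tends to `0`.
    have hbz : s * ‖z‖ ≤ 2 * B + 1 + s ^ 2 * ‖z₀‖ ^ 2 := by
      have h0 : -B ≤ u z₀ := (abs_le.1 (hub z₀)).1
      have h1 : (s * ‖z‖) ^ 2 ≤ 4 * B + s ^ 2 * ‖z₀‖ ^ 2 := by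
        rw [mul_pow]
        linarith [(abs_le.1 (hub z)).2, (abs_le.1 (hvb w)).1, (abs_le.1 (hvb z₀)).2]
      nlinarith [sq_nonneg (s * ‖z‖ - 1), sq_nonneg (s * ‖z₀‖)]
    have h3 : K * (2 * c * ‖z - w‖ + 1) * ‖z - w‖ ≤ K * (2 * s ^ 2 + s) := by
      rw [mul_assoc]
      gcongr
      linarith
    have h4 : M * (2 * s ^ 2 * ‖z‖) ≤ M * (2 * s * (2 * B + 1 + s ^ 2 * ‖z₀‖ ^ 2)) := by
      have : 2 * s ^ 2 * ‖z‖ = 2 * s * (s * ‖z‖) := by ring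
      rw [this]
      gcongr
    have h5 : γ * (u z₀ - v z₀ - s ^ 2 * ‖z₀‖ ^ 2) ≤ γ * (u z - v w) := by
      have : 0 ≤ s ^ 2 * ‖z‖ ^ 2 := by positivity
      exact mul_le_mul_of_nonneg_left (by linarith) hγ.le
    linarith
  have hlim : γ * (u z₀ - v z₀) ≤ 0 := by
    have hcont : Continuous fun s : ℝ => γ * (s ^ 2 * ‖z₀‖ ^ 2) + K * (2 * s ^ 2 + s) +
      M * (2 * s * (2 * B + 1 + s ^ 2 * ‖z₀‖ ^ 2)) := by fun_prop
    have htend := (hcont.tendsto 0).mono_left (nhdsWithin_le_nhds (s := Ioi 0))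
    refine ge_of_tendsto (by simpa using htend) ?_
    filter_upwards [self_mem_nhdsWithin] with s hs using key s hs
  nlinarith

end Comparison

/-- The common gradient `p` meets only the difference `f z - f w`, because its terms `L ‖p.snd‖`
cancel; the extra gradient `p'` costs at most `C + L` per unit of norm. -/
theorem hjbFunction_structure {n m : ℕ} {f : StateAction n m → EuclideanSpace ℝ (Fin n)}
    {r : StateAction n m → ℝ} {C K γ L : ℝ} (H : IsBoundedLipschitz f r C K) (hL : 0 ≤ L)
    (z w : StateAction n m) (q q' : ℝ) (p p' : StateAction n m) :
    γ * (q - q') ≤ hjbFunction f r γ L z q (p + p') - hjbFunction f r γ L w q' p +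
      K * (‖p‖ + 1) * ‖z - w‖ + (C + L) * ‖p'‖ := by
  have hK := H.K_pos.le
  have hC := H.C_nonneg
  have e1 : (p + p').fst = p.fst + p'.fst := rfl
  have e2 : (p + p').snd = p.snd + p'.snd := rfl
  rw [hjbFunction, hjbFunction, e1, e2, inner_add_left]
  have h1 : inner ℝ p.fst (f z) - inner ℝ p.fst (f w) ≤ ‖p‖ * (K * ‖z - w‖) := by
    rw [← inner_sub_right]
    exact (real_inner_le_norm _ _).trans
      (mul_le_mul (norm_fst_le p) (H.norm_f_sub_le z w) (norm_nonneg _) (norm_nonneg _))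
  have h2 : inner ℝ p'.fst (f z) ≤ ‖p'‖ * C :=
    (real_inner_le_norm _ _).trans
      (mul_le_mul (norm_fst_le p') (H.norm_f_le z) (norm_nonneg _) (norm_nonneg _))
  have h3 : L * ‖p.snd + p'.snd‖ ≤ L * (‖p.snd‖ + ‖p'‖) := by
    gcongr
    exact (norm_add_le _ _).trans (by gcongr; exact norm_snd_le p')
  have h4 := (abs_le.1 (H.abs_r_sub_le z w)).2
  linarith

theorem mainTheorem1 (n m : ℕ)
    (f : StateAction n m → EuclideanSpace ℝ (Fin n)) (r : StateAction n m → ℝ) (γ L : ℝ)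
    (hγ : 0 < γ) (hL : 0 ≤ L)
    (hf_bdd : ∃ C : ℝ, ∀ z, ‖f z‖ ≤ C) (hf_lip : ∃ K, LipschitzWith K f)
    (hr_bdd : ∃ C : ℝ, ∀ z, |r z| ≤ C) (hr_lip : ∃ K, LipschitzWith K r) :
    -- the supremum that defines the Q-function is a genuine one, and the Q-function is bounded
    (∀ z, IsLUB (attainableRewards f r γ L z) (optimalQ f r γ L z)) ∧
    (∃ C : ℝ, ∀ z, |optimalQ f r γ L z| ≤ C) ∧
    IsViscositySolution (hjbFunction f r γ L) (optimalQ f r γ L) ∧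
    ∀ u : StateAction n m → ℝ, (∃ C : ℝ, ∀ z, |u z| ≤ C) →
      IsViscositySolution (hjbFunction f r γ L) u → u = optimalQ f r γ L := by
  obtain ⟨C, K, H⟩ := exists_of_bounded_lipschitz hf_bdd hf_lip hr_bdd hr_lip
  have hQ := isViscositySolution_optimalQ H hγ hL
  refine ⟨isLUB_optimalQ H hγ hL, ⟨_, abs_optimalQ_le H hγ hL⟩, hQ, ?_⟩
  rintro u ⟨B, hB⟩ hu
  have hub : ∀ z, |u z| ≤ max B (C / γ) := fun z => (hB z).trans (le_max_left _ _)
  have hQb : ∀ z, |optimalQ f r γ L z| ≤ max B (C / γ) := fun z =>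
    (abs_optimalQ_le H hγ hL z).trans (le_max_right _ _)
  have hCL : 0 ≤ C + L := add_nonneg H.C_nonneg hL
  funext z
  exact le_antisymm
    (hu.le_of_isViscositySolution hγ H.K_pos.le hCL (hjbFunction_structure H hL) hQ hub hQb z)
    (hQ.le_of_isViscositySolution hγ H.K_pos.le hCL (hjbFunction_structure H hL) hu hQb hub z)
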